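/- **Setting.** A bilevel problem on $\mathbb R^p\times\mathbb R^q$ is a pair of functions $f,g:\mathbb R^p\times\mathbb R^q\to\mathbb R$; put $y^*(x)=\arg\min_y g(x,y)$ and $\Phi(x)=f(x,y^*(x))$. For constants $L_x,L_{xy},L_y,\widetilde L_{xy},\rho_{xy},\rho_{yy}\ge 0$, $0<\mu_y\le\widetilde L_y$ and $B>0$, the class $\mathcal F_{csc}$ consists of the problems with $f,g$ twice continuously differentiable such that: $\nabla_xf$ is $L_x$-Lipschitz in $x$ and $L_{xy}$-Lipschitz in $y$; $\nabla_yf$ is $L_{xy}$-Lipschitz in $x$ and $L_y$-Lipschitz in $y$; $\nabla_yg$ is $\widetilde L_{xy}$-Lipschitz in $x$ and $\widetilde L_y$-Lipschitz in $y$; $\nabla_x\nabla_yg$ and $\nabla_y^2g$ are $\rho_{xy}$- and $\rho_{yy}$-Lipschitz in $(x,y)$; $\Phi$ is convex; every $g(x,\cdot)$ is $\mu_y$-strongly convex; and $\Phi$ has a minimizer $x^*$ with $\|x^*\|=B$. **Algorithm class.** A run of a hypergradient-based algorithm has integers $K\ge 0$, $Q\ge1$, $T\ge1$ and update times $0\le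 s_0<\dots<s_{Q-1}\le K$. Its search spaces are $\mathcal H_x^0=\mathcal H_y^0=\{0\}$ and, for $0\le k<K$, $$\mathcal H_y^{k+1}=\mathrm{Span}\{y_i,\ \nabla_yg(\tilde x_i,\tilde y_i)\;:\;\tilde x_i\in\mathcal H_x^i,\ y_i,\tilde y_i\in\mathcal H_y^i,\ 0\le i\le k\};$$ if $k\ge1$ is an update time, then $$\mathcal H_x^{k}=\mathrm{Span}\Big\{x_i,\ \nabla_xf(\tilde x_i,\tilde y_i),\ \nabla_x\nabla_yg(x_i',y_i')\prod_{j=1}^t\big(I-\alpha\nabla_y^2g(x_{i,j},y_{i,j})\big)\nabla_yf(\hat x_i,\hat y_i)\Big\},$$ over $0\le t\le T$, $\alpha\in\mathbb R$, $0\le i\le k-1$ and all points of $\mathcal H_x^i$, $\mathcal H_y^i$; if $k\ge1$ is not an update time, then $\mathcal H_x^k=\mathcal H_x^{k-1}$. The iterates satisfy $x^k\in\mathcal H_x^k$, $y^k\in\mathcal H_y^k$ for $0\le k\le K$, and the output is $x^K$. With $n_J=Q$ Jacobian-vector products, $n_H=QT$ Hessian-vector products and $n_G=K$ gradient evaluations,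 the cost of the run is $\tau(n_J+n_H)+n_G$, where $\tau>0$. For an algorithm $\mathcal A$ of the class, $\mathcal C_{norm}(\mathcal A,\epsilon)$ is the least cost of its runs on the given problem with $\|\nabla\Phi(x^K)\|\le\epsilon$ ($\infty$ if there are none). **Theorem.** Given such constants and $\epsilon>0$, let $\beta=(\widetilde L_y-\mu_y)/4$ and let $r^*$ be the unique nonnegative solution (which exists) of $$r^4+r\Big(\frac{2\beta^4}{\mu_y^4}+\frac{4\beta^3}{\mu_y^3}+\frac{4\beta^2}{\mu_y^2}\Big)=\frac{B^2(\widetilde L_{xy}^2L_y+L_x\mu_y^2)^2}{128\,\mu_y^4\epsilon^2}.$$ There is an instance in $\mathcal F_{csc}$, with some dimensions $p=q=d$, such that every run of every hypergradient-based algorithm whose output satisfies $\|\nabla\Phi(x^K)\|\le\epsilon$ has $$M=K+QT-Q+3\ \ge\ \lfloor r^*\rfloor-3 .$$ Moreover, for every algorithm $\mathcal A$ of the class and every $\tau>0$, on this same instance: 1. $\mathcal C_{norm}(\mathcal A,\epsilon)\ge c_0\,r^*$, where $c_0>0$ depends only on $\tau$; 2. if $\beta\le\kappa\mu_y$ with $\kappa>0$,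 then $\mathcal C_{norm}(\mathcal A,\epsilon)\ge c_1\,\dfrac{B^{1/2}(\widetilde L_{xy}^2L_y+L_x\mu_y^2)^{1/2}}{\mu_y\,\epsilon^{1/2}}$, where $c_1>0$ depends only on $\tau,\kappa$; 3. if $\beta\le\beta_0$ with $\beta_0>0$, and $L_y,\widetilde L_{xy}>0$, then $\mathcal C_{norm}(\mathcal A,\epsilon)\ge c_2\,\dfrac1{\sqrt\epsilon}\min\Big\{\dfrac1{\mu_y},\dfrac1{\sqrt{\epsilon^3}}\Big\}$, where $c_2>0$ depends only on $\tau,\beta_0,L_x,L_y,\widetilde L_{xy},B$. -/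

import Mathlib

noncomputable section

/-- A bilevel problem: minimise `Φ x = f x (y* x)` over `x`, where `y* x` minimises `g x`. -/
structure BilevelProblem (p q : ℕ) where
  /-- outer-level function -/
  f : EuclideanSpace ℝ (Fin p) → EuclideanSpace ℝ (Fin q) → ℝ
  /-- inner-level function -/
  g : EuclideanSpace ℝ (Fin p) → EuclideanSpace ℝ (Fin q) → ℝ

namespace BilevelProblem

variable {p q : ℕ} (P : BilevelProblem p q)

/-- `∇ₓ f (x, y)` -/
def gradXf (x : EuclideanSpace ℝ (Fin p)) (y : EuclideanSpace ℝ (Fin q)) :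
    EuclideanSpace ℝ (Fin p) :=
  gradient (fun x' => P.f x' y) x

/-- `∇_y f (x, y)` -/
def gradYf (x : EuclideanSpace ℝ (Fin p)) (y : EuclideanSpace ℝ (Fin q)) :
    EuclideanSpace ℝ (Fin q) :=
  gradient (fun y' => P.f x y') y

/-- `∇_y g (x, y)` -/
def gradYg (x : EuclideanSpace ℝ (Fin p)) (y : EuclideanSpace ℝ (Fin q)) :
    EuclideanSpace ℝ (Fin q) :=
  gradient (fun y' => P.g x y') y

/-- The Hessian `∇_y² g (x, y)`, as an operator on `ℝ^q`. -/
def hessYg (x : EuclideanSpace ℝ (Fin p)) (y : EuclideanSpace ℝ (Fin q)) :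
    EuclideanSpace ℝ (Fin q) →L[ℝ] EuclideanSpace ℝ (Fin q) :=
  fderiv ℝ (fun y' => P.gradYg x y') y

/-- The mixed derivative `∇ₓ∇_y g (x, y)`, i.e. the `p × q` matrix `(∂²g / ∂xᵢ ∂yⱼ)`, as an
operator `ℝ^q → ℝ^p`: the transpose of the derivative of `∇_y g (·, y)`. -/
def jacXYg (x : EuclideanSpace ℝ (Fin p)) (y : EuclideanSpace ℝ (Fin q)) :
    EuclideanSpace ℝ (Fin q) →L[ℝ] EuclideanSpace ℝ (Fin p) :=
  ContinuousLinearMap.adjoint (fderiv ℝ (fun x' => P.gradYg x' y) x)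

/-- `y* x`, a minimiser of `g x` (it exists and is unique when `g x` is strongly convex and
continuous). -/
def yStar (x : EuclideanSpace ℝ (Fin p)) : EuclideanSpace ℝ (Fin q) :=
  Classical.epsilon fun y => ∀ y', P.g x y ≤ P.g x y'

/-- The total objective `Φ x = f x (y* x)`. -/
def Phi (x : EuclideanSpace ℝ (Fin p)) : ℝ :=
  P.f x (P.yStar x)

end BilevelProblem

/-- Membership in the convex–strongly-convex class with smoothness constants
`Lx, Lxy, Ly` (for `f`), `Ltxy, Lty` (for `g`), Lipschitz constants `ρxy, ρyy` of the second
derivatives of `g`, strong convexity constant `μy`, and norm `B` of a minimiser of `Φ`. -/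
structure InCSC {p q : ℕ} (Lx Lxy Ly Ltxy Lty ρxy ρyy μy B : ℝ) (P : BilevelProblem p q) :
    Prop where
  contDiff_f : ContDiff ℝ 2
    (fun z : EuclideanSpace ℝ (Fin p) × EuclideanSpace ℝ (Fin q) => P.f z.1 z.2)
  contDiff_g : ContDiff ℝ 2
    (fun z : EuclideanSpace ℝ (Fin p) × EuclideanSpace ℝ (Fin q) => P.g z.1 z.2)
  gradXf_x : ∀ x₁ x₂ y, ‖P.gradXf x₁ y - P.gradXf x₂ y‖ ≤ Lx * ‖x₁ - x₂‖
  gradXf_y : ∀ x y₁ y₂, ‖P.gradXf x y₁ - P.gradXf x y₂‖ ≤ Lxy * ‖y₁ - y₂‖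
  gradYf_x : ∀ x₁ x₂ y, ‖P.gradYf x₁ y - P.gradYf x₂ y‖ ≤ Lxy * ‖x₁ - x₂‖
  gradYf_y : ∀ x y₁ y₂, ‖P.gradYf x y₁ - P.gradYf x y₂‖ ≤ Ly * ‖y₁ - y₂‖
  gradYg_x : ∀ x₁ x₂ y, ‖P.gradYg x₁ y - P.gradYg x₂ y‖ ≤ Ltxy * ‖x₁ - x₂‖
  gradYg_y : ∀ x y₁ y₂, ‖P.gradYg x y₁ - P.gradYg x y₂‖ ≤ Lty * ‖y₁ - y₂‖
  jacXYg_lip : ∀ x₁ x₂ y₁ y₂, ‖P.jacXYg x₁ y₁ - P.jacXYg x₂ y₂‖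
    ≤ ρxy * Real.sqrt (‖x₁ - x₂‖ ^ 2 + ‖y₁ - y₂‖ ^ 2)
  hessYg_lip : ∀ x₁ x₂ y₁ y₂, ‖P.hessYg x₁ y₁ - P.hessYg x₂ y₂‖
    ≤ ρyy * Real.sqrt (‖x₁ - x₂‖ ^ 2 + ‖y₁ - y₂‖ ^ 2)
  convex_Phi : ConvexOn ℝ Set.univ P.Phi
  strongConvex_g : ∀ x, StrongConvexOn Set.univ μy (P.g x)
  exists_minimizer : ∃ xs, (∀ x, P.Phi xs ≤ P.Phi x) ∧ ‖xs‖ = B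

/-- The parameters of a hypergradient-based method: `K` iterations, of which the `Q` iterations
`s 0 < … < s (Q-1) ≤ K` update `x`, each update using at most `T` Hessian–vector products. -/
structure UpdateSchedule where
  K : ℕ
  Q : ℕ
  T : ℕ
  Q_pos : 0 < Q
  T_pos : 0 < T
  s : Fin Q → ℕ
  s_strictMono : StrictMono s
  s_le : ∀ m, s m ≤ K

namespace BilevelProblem

variable {p q : ℕ} (P : BilevelProblem p q)

/-- What the points of the search spaces `X`, `Y` contribute to a later search space for `y`. -/
def yGenerators (X : Submodule ℝ (EuclideanSpace ℝ (Fin p)))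
    (Y : Submodule ℝ (EuclideanSpace ℝ (Fin q))) : Set (EuclideanSpace ℝ (Fin q)) :=
  {v | v ∈ Y ∨ ∃ x ∈ X, ∃ y ∈ Y, v = P.gradYg x y}

/-- What the points of the search spaces `X`, `Y` contribute to a later search space for `x`:
points of `X`, gradients `∇ₓ f`, and the vectors
`∇ₓ∇_y g (x₀, y₀) ∏_{j ≤ t} (I - α ∇_y² g (xsⱼ, ysⱼ)) ∇_y f (x̂, ŷ)` with `t ≤ T`. -/
def xGenerators (T : ℕ) (X : Submodule ℝ (EuclideanSpace ℝ (Fin p)))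
    (Y : Submodule ℝ (EuclideanSpace ℝ (Fin q))) : Set (EuclideanSpace ℝ (Fin p)) :=
  {v | v ∈ X ∨ (∃ x ∈ X, ∃ y ∈ Y, v = P.gradXf x y) ∨
    ∃ t ≤ T, ∃ α : ℝ, ∃ x₀ ∈ X, ∃ y₀ ∈ Y, ∃ xh ∈ X, ∃ yh ∈ Y,
      ∃ xs : Fin t → EuclideanSpace ℝ (Fin p), ∃ ys : Fin t → EuclideanSpace ℝ (Fin q),
        (∀ j, xs j ∈ X) ∧ (∀ j, ys j ∈ Y) ∧
        v = P.jacXYg x₀ y₀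
          ((List.ofFn fun j => 1 - α • P.hessYg (xs j) (ys j)).prod (P.gradYf xh yh))}

open Classical in
/-- The pair of search spaces `(H_x^k, H_y^k)`. -/
def searchSpaces (S : UpdateSchedule) :
    ℕ → Submodule ℝ (EuclideanSpace ℝ (Fin p)) × Submodule ℝ (EuclideanSpace ℝ (Fin q))
  | 0 => (⊥, ⊥)
  | k + 1 =>
    (if ∃ m, S.s m = k + 1 then
        Submodule.span ℝ (⋃ i : Fin (k + 1),
          P.xGenerators S.T (searchSpaces S i.1).1 (searchSpaces S i.1).2)
      else (searchSpaces S k).1,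
      Submodule.span ℝ (⋃ i : Fin (k + 1),
        P.yGenerators (searchSpaces S i.1).1 (searchSpaces S i.1).2))
  termination_by k => k
  decreasing_by all_goals omega

end BilevelProblem

/-- A run, on the problem `P`, of a method of the hypergradient-based class. -/
structure HypergradientRun {p q : ℕ} (P : BilevelProblem p q) where
  schedule : UpdateSchedule
  x : ℕ → EuclideanSpace ℝ (Fin p)
  y : ℕ → EuclideanSpace ℝ (Fin q)
  x_mem : ∀ k ≤ schedule.K, x k ∈ (P.searchSpaces schedule k).1
  y_mem : ∀ k ≤ schedule.K, y k ∈ (P.searchSpaces schedule k).2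

namespace HypergradientRun

variable {p q : ℕ} {P : BilevelProblem p q} (R : HypergradientRun P)

/-- The output `x^K`. -/
def output : EuclideanSpace ℝ (Fin p) := R.x R.schedule.K

/-- number of Jacobian–vector products: one per update of `x` -/
def nJ : ℕ := R.schedule.Q

/-- number of Hessian–vector products: `T` per update of `x` -/
def nH : ℕ := R.schedule.Q * R.schedule.T

/-- number of gradient evaluations: one per iteration -/
def nG : ℕ := R.schedule.K

/-- The cost `τ (n_J + n_H) + n_G` of a run. -/
def cost (τ : ℝ) : ℝ := τ * (R.nJ + R.nH) + R.nG

end HypergradientRun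

/-- An algorithm of the hypergradient-based class, described by the runs that it can carry out
on each problem. -/
def HypergradientAlgorithm : Type :=
  ∀ (p q : ℕ) (P : BilevelProblem p q), Set (HypergradientRun P)

/-- The complexity `C_norm(A, ε)` of the algorithm `A` on the problem `P`: the least cost of a
run whose output satisfies `‖∇Φ(x^K)‖ ≤ ε`, and `∞` if there is no such run. -/
def normComplexity (τ : ℝ) (A : HypergradientAlgorithm) {p q : ℕ} (P : BilevelProblem p q)
    (ε : ℝ) : ENNReal :=
  ⨅ R ∈ A p q P, ⨅ _ : ‖gradient P.Phi R.output‖ ≤ ε, ENNReal.ofReal (R.cost τ)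

/-- `r` is the nonnegative solution `r*` of the equation
`r⁴ + r (2β⁴/μ⁴ + 4β³/μ³ + 4β²/μ²) = B² (L̃xy² Ly + Lx μ²)² / (128 μ⁴ ε²)`. -/
def IsRStar (Lx Ly Ltxy μy β B ε r : ℝ) : Prop :=
  0 ≤ r ∧
    r ^ 4 + r * (2 * β ^ 4 / μy ^ 4 + 4 * β ^ 3 / μy ^ 3 + 4 * β ^ 2 / μy ^ 2) =
      B ^ 2 * (Ltxy ^ 2 * Ly + Lx * μy ^ 2) ^ 2 / (128 * μy ^ 4 * ε ^ 2)

end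

/-! The hard instance is a chain. Let `Z` be the lower bidiagonal difference matrix of size `n + 1`
and `b = t e₀`. Take outer function `Lx/8 ‖Z x - b‖² + Ly/2 ‖y‖²` and inner function `μ/2 ‖y‖² - L/2
⟪Z x - b, y⟫`. Then `y* x` is a multiple of `Z x - b`, so `Φ` is a multiple of `‖Z x - b‖²`,
minimised at `t (1, …, 1)`.

The inner Hessian is `μ I`, so Hessian products only rescale. `Z` shifts the support by one and `Zᵀ`
not at all, hence after `k` iterations only the first `k` coordinates can be nonzero
(`searchSpaces_le`), whatever `Q` and `T` are.

While the last coordinate is zero, pairing `Zᵀ (Z x - b)` with `(1, 2, …, n + 1)` gives `-t`, so its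
norm is at least `t (n + 1)^(-3/2)` (`le_norm_adjoint_backwardDifference`). With `t = B / √(n + 1)`
and `n + 1 = ⌊r*⌋` this exceeds the allowed accuracy. Hence `K ≥ ⌊r*⌋` (`exists_hard_instance`),
more than the claimed bound on `M`. The `β` terms in the equation only lower `r*`; they matter only
when `r*` is compared with explicit rates. -/

open scoped InnerProductSpace

/-! ### Gradients of quadratic functions -/

section Gradient

variable {E F : Type*} [NormedAddCommGroup E] [InnerProductSpace ℝ E] [CompleteSpace E]
  [NormedAddCommGroup F] [InnerProductSpace ℝ F] [CompleteSpace F]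

/-- The gradient of a least-squares function, up to an additive constant. -/
theorem hasGradientAt_norm_sq_affine (Z : E →L[ℝ] F) (b : F) (a c : ℝ) (x : E) :
    HasGradientAt (fun x => a / 2 * ‖Z x - b‖ ^ 2 + c)
      (a • ContinuousLinearMap.adjoint Z (Z x - b)) x := by
  rw [hasGradientAt_iff_hasFDerivAt]
  have h := (((Z.hasFDerivAt (x := x)).sub_const b).norm_sq.const_mul (a / 2)).add_const c
  refine h.congr_fderiv ?_
  ext v
  simp [ContinuousLinearMap.adjoint_inner_left]
  ring

theorem hasGradientAt_norm_sq_sub_inner (μ : ℝ) (w y : E) :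
    HasGradientAt (fun y => μ / 2 * ‖y‖ ^ 2 - ⟪w, y⟫_ℝ) (μ • y - w) y := by
  rw [hasGradientAt_iff_hasFDerivAt]
  have h := ((hasFDerivAt_id (𝕜 := ℝ) y).norm_sq.const_mul (μ / 2)).sub
    ((innerSL ℝ w).hasFDerivAt (x := y))
  refine h.congr_fderiv ?_
  ext v
  simp
  ring

end Gradient

/-- Completing the square. -/
theorem norm_sq_sub_inner_eq {E : Type*} [NormedAddCommGroup E] [InnerProductSpace ℝ E] {μ : ℝ}
    (hμ : μ ≠ 0) (w y : E) :
    μ / 2 * ‖y‖ ^ 2 - ⟪w, y⟫_ℝ = μ / 2 * ‖y - μ⁻¹ • w‖ ^ 2 - ‖w‖ ^ 2 / (2 * μ) := by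
  rw [norm_sub_sq_real, norm_smul, real_inner_smul_right, real_inner_comm w y, mul_pow,
    Real.norm_eq_abs, sq_abs]
  field_simp
  ring

/-! ### The least-squares bilevel problem and its membership in the class -/

/-- The problem with outer function `Lx/8 ‖Z x - b‖² + Ly/2 ‖y‖²` and inner function
`μ/2 ‖y‖² - L/2 ⟪Z x - b, y⟫`. Its inner curvature is the least that `μ`-strong convexity allows,
so that products with the inner Hessian reveal nothing. -/
noncomputable def leastSquaresBilevel {d : ℕ}
    (Z : EuclideanSpace ℝ (Fin d) →L[ℝ] EuclideanSpace ℝ (Fin d)) (b : EuclideanSpace ℝ (Fin d))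
    (Lx Ly L μ : ℝ) : BilevelProblem d d where
  f x y := Lx / 8 * ‖Z x - b‖ ^ 2 + Ly / 2 * ‖y‖ ^ 2
  g x y := μ / 2 * ‖y‖ ^ 2 - L / 2 * ⟪Z x - b, y⟫_ℝ

namespace leastSquaresBilevel

variable {d : ℕ} (Z : EuclideanSpace ℝ (Fin d) →L[ℝ] EuclideanSpace ℝ (Fin d))
  (b : EuclideanSpace ℝ (Fin d)) (Lx Ly L μ : ℝ) (x y : EuclideanSpace ℝ (Fin d))

theorem gradXf_eq : (leastSquaresBilevel Z b Lx Ly L μ).gradXf x y =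
    (Lx / 4) • ContinuousLinearMap.adjoint Z (Z x - b) := by
  have h := hasGradientAt_norm_sq_affine Z b (Lx / 4) (Ly / 2 * ‖y‖ ^ 2) x
  rw [div_div, show (4 : ℝ) * 2 = 8 by norm_num] at h
  exact h.gradient

theorem gradYf_eq : (leastSquaresBilevel Z b Lx Ly L μ).gradYf x y = Ly • y := by
  have h := hasGradientAt_norm_sq_affine (ContinuousLinearMap.id ℝ (EuclideanSpace ℝ (Fin d))) 0 Ly
    (Lx / 8 * ‖Z x - b‖ ^ 2) y
  simp only [ContinuousLinearMap.id_apply, sub_zero, ContinuousLinearMap.adjoint_id] at h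
  simpa only [BilevelProblem.gradYf, leastSquaresBilevel, add_comm] using h.gradient

theorem gradYg_eq : (leastSquaresBilevel Z b Lx Ly L μ).gradYg x y =
    μ • y - (L / 2) • (Z x - b) := by
  have h := hasGradientAt_norm_sq_sub_inner μ ((L / 2) • (Z x - b)) y
  simp only [real_inner_smul_left] at h
  exact h.gradient

theorem hessYg_eq : (leastSquaresBilevel Z b Lx Ly L μ).hessYg x y = μ • 1 := by
  unfold BilevelProblem.hessYg
  simp only [gradYg_eq]
  exact (((hasFDerivAt_id (𝕜 := ℝ) y).const_smul μ).sub_const _).fderiv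

theorem jacXYg_eq : (leastSquaresBilevel Z b Lx Ly L μ).jacXYg x y =
    (-(L / 2)) • ContinuousLinearMap.adjoint Z := by
  unfold BilevelProblem.jacXYg
  simp only [gradYg_eq]
  have h := (((Z.hasFDerivAt (x := x)).sub_const b).const_smul (L / 2)).const_sub (μ • y)
  have h' : fderiv ℝ (fun x' => μ • y - (L / 2) • (Z x' - b)) x = -((L / 2) • Z) := h.fderiv
  rw [h', map_neg, map_smulₛₗ, neg_smul]
  simp

variable {μ}

/-- Completing the square in `y` leaves a constant plus a squared distance, so the minimiser
selected by `Classical.epsilon` exists and is unique. -/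
theorem yStar_eq (hμ : 0 < μ) : (leastSquaresBilevel Z b Lx Ly L μ).yStar x =
    (L / (2 * μ)) • (Z x - b) := by
  have hg : ∀ y, (leastSquaresBilevel Z b Lx Ly L μ).g x y =
      μ / 2 * ‖y - (L / (2 * μ)) • (Z x - b)‖ ^ 2 - ‖(L / 2) • (Z x - b)‖ ^ 2 / (2 * μ) := by
    intro y
    have h := norm_sq_sub_inner_eq hμ.ne' ((L / 2) • (Z x - b)) y
    rw [real_inner_smul_left, smul_smul, show μ⁻¹ * (L / 2) = L / (2 * μ) by field_simp] at h
    exact h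
  have hmin : ∀ y', (leastSquaresBilevel Z b Lx Ly L μ).g x
      ((leastSquaresBilevel Z b Lx Ly L μ).yStar x) ≤
      (leastSquaresBilevel Z b Lx Ly L μ).g x y' := by
    refine Classical.epsilon_spec (p := fun y => ∀ y', (leastSquaresBilevel Z b Lx Ly L μ).g x y ≤
      (leastSquaresBilevel Z b Lx Ly L μ).g x y') ⟨(L / (2 * μ)) • (Z x - b), fun y' => ?_⟩
    rw [hg, hg]
    simp only [sub_self, norm_zero]
    have : 0 ≤ μ / 2 * ‖y' - (L / (2 * μ)) • (Z x - b)‖ ^ 2 := by positivity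
    linarith
  have h := hmin ((L / (2 * μ)) • (Z x - b))
  rw [hg, hg] at h
  simp only [sub_self, norm_zero] at h
  have h0 : ‖(leastSquaresBilevel Z b Lx Ly L μ).yStar x - (L / (2 * μ)) • (Z x - b)‖ ^ 2 = 0 := by
    refine le_antisymm ?_ (sq_nonneg _)
    by_contra! hpos
    have : 0 < μ / 2 * ‖(leastSquaresBilevel Z b Lx Ly L μ).yStar x -
      (L / (2 * μ)) • (Z x - b)‖ ^ 2 := by positivity
    linarith
  exact sub_eq_zero.1 (norm_eq_zero.1 (pow_eq_zero_iff two_ne_zero |>.1 h0))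

/-- Since `y* x` is proportional to the residual `Z x - b`, both terms of `f` collapse into one. The
form `/ 4 / 2 * … + 0` matches `hasGradientAt_norm_sq_affine`. -/
theorem Phi_eq (hμ : 0 < μ) : (leastSquaresBilevel Z b Lx Ly L μ).Phi =
    fun x => (Lx + L ^ 2 * Ly / μ ^ 2) / 4 / 2 * ‖Z x - b‖ ^ 2 + 0 := by
  funext x
  rw [BilevelProblem.Phi, yStar_eq Z b Lx Ly L x hμ]
  simp only [leastSquaresBilevel, norm_smul, mul_pow, Real.norm_eq_abs, sq_abs]
  field_simp
  ring

theorem gradient_Phi_eq (hμ : 0 < μ) : gradient (leastSquaresBilevel Z b Lx Ly L μ).Phi x =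
    ((Lx + L ^ 2 * Ly / μ ^ 2) / 4) • ContinuousLinearMap.adjoint Z (Z x - b) := by
  rw [Phi_eq Z b Lx Ly L hμ]
  exact (hasGradientAt_norm_sq_affine Z b _ 0 x).gradient

variable {Z b Lx Ly L}

/-- The factors `1/8` and `1/2` in the instance absorb `‖Z‖ ≤ 2`: they give `Lx/4 · 2²= Lx` and `L/2
· 2 = L`. The bounds with `Lxy`, `ρxy`, `ρyy` hold because the quantities compared are equal. -/
theorem inCSC {Lxy Lty ρxy ρyy B : ℝ} (hLx : 0 ≤ Lx) (hLxy : 0 ≤ Lxy) (hLy : 0 ≤ Ly)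
    (hL : 0 ≤ L) (hρxy : 0 ≤ ρxy) (hρyy : 0 ≤ ρyy) (hμ : 0 < μ) (hμL : μ ≤ Lty)
    (hZ : ‖Z‖ ≤ 2) {xs : EuclideanSpace ℝ (Fin d)} (hxs : Z xs = b) (hB : ‖xs‖ = B) :
    InCSC Lx Lxy Ly L Lty ρxy ρyy μ B (leastSquaresBilevel Z b Lx Ly L μ) where
  contDiff_f := by
    have h1 : ContDiff ℝ 2 (fun z : EuclideanSpace ℝ (Fin d) × EuclideanSpace ℝ (Fin d) =>
      Z z.1 - b) := by fun_prop
    exact (contDiff_const.mul (h1.norm_sq ℝ)).add (contDiff_const.mul (contDiff_snd.norm_sq ℝ))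
  contDiff_g := by
    have h1 : ContDiff ℝ 2 (fun z : EuclideanSpace ℝ (Fin d) × EuclideanSpace ℝ (Fin d) =>
      Z z.1 - b) := by fun_prop
    exact (contDiff_const.mul (contDiff_snd.norm_sq ℝ)).sub
      (contDiff_const.mul (h1.inner ℝ contDiff_snd))
  gradXf_x x₁ x₂ y := by
    rw [gradXf_eq, gradXf_eq, ← smul_sub, ← map_sub, sub_sub_sub_cancel_right, ← map_sub,
      norm_smul, Real.norm_of_nonneg (by positivity)]
    have h1 := (ContinuousLinearMap.adjoint Z).le_opNorm (Z (x₁ - x₂))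
    have h2 := Z.le_opNorm (x₁ - x₂)
    rw [LinearIsometryEquiv.norm_map] at h1
    have h3 : ‖(ContinuousLinearMap.adjoint Z) (Z (x₁ - x₂))‖ ≤ 2 * (2 * ‖x₁ - x₂‖) :=
      h1.trans (by gcongr; exact h2.trans (by gcongr))
    calc Lx / 4 * ‖(ContinuousLinearMap.adjoint Z) (Z (x₁ - x₂))‖
        ≤ Lx / 4 * (2 * (2 * ‖x₁ - x₂‖)) := by gcongr
      _ = Lx * ‖x₁ - x₂‖ := by ring
  gradXf_y x y₁ y₂ := by
    rw [gradXf_eq, gradXf_eq, sub_self, norm_zero]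
    positivity
  gradYf_x x₁ x₂ y := by
    rw [gradYf_eq, gradYf_eq, sub_self, norm_zero]
    positivity
  gradYf_y x y₁ y₂ := by
    rw [gradYf_eq, gradYf_eq, ← smul_sub, norm_smul, Real.norm_of_nonneg hLy]
  gradYg_x x₁ x₂ y := by
    rw [gradYg_eq, gradYg_eq, sub_sub_sub_cancel_left, ← smul_sub, sub_sub_sub_cancel_right,
      ← map_sub, norm_smul, Real.norm_of_nonneg (by positivity), norm_sub_rev x₁]
    have h2 : ‖Z (x₂ - x₁)‖ ≤ 2 * ‖x₂ - x₁‖ := (Z.le_opNorm _).trans (by gcongr)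
    calc L / 2 * ‖Z (x₂ - x₁)‖ ≤ L / 2 * (2 * ‖x₂ - x₁‖) := by gcongr
      _ = L * ‖x₂ - x₁‖ := by ring
  gradYg_y x y₁ y₂ := by
    rw [gradYg_eq, gradYg_eq, sub_sub_sub_cancel_right, ← smul_sub, norm_smul,
      Real.norm_of_nonneg hμ.le]
    gcongr
  jacXYg_lip x₁ x₂ y₁ y₂ := by
    rw [jacXYg_eq, jacXYg_eq, sub_self, norm_zero]
    positivity
  hessYg_lip x₁ x₂ y₁ y₂ := by
    rw [hessYg_eq, hessYg_eq, sub_self, norm_zero]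
    positivity
  convex_Phi := by
    rw [Phi_eq Z b Lx Ly L hμ]
    have h1 : ConvexOn ℝ Set.univ (fun u : EuclideanSpace ℝ (Fin d) => ‖u‖ ^ 2) :=
      convexOn_univ_norm.pow (fun _ _ => norm_nonneg _) 2
    have h2 := (h1.translate_left (-b)).comp_linearMap Z.toLinearMap
    have h3 := (h2.smul (c := (Lx + L ^ 2 * Ly / μ ^ 2) / 4 / 2) (by positivity)).add_const 0
    exact h3.congr fun x _ => by simp [sub_eq_add_neg]
  strongConvex_g x := by
    rw [strongConvexOn_iff_convex]
    have h : ConvexOn ℝ Set.univ (innerₗ _ (-((L / 2) • (Z x - b)))) :=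
      LinearMap.convexOn _ convex_univ
    exact h.congr fun y _ => by simp [leastSquaresBilevel, inner_sub_left]
  exists_minimizer := by
    refine ⟨xs, fun x => ?_, hB⟩
    rw [Phi_eq Z b Lx Ly L hμ]
    simp only [hxs, sub_self, norm_zero]
    have : 0 ≤ (Lx + L ^ 2 * Ly / μ ^ 2) / 4 / 2 * ‖Z x - b‖ ^ 2 := by positivity
    simpa using this

end leastSquaresBilevel

/-! ### The difference matrix -/

namespace LowerBidiagonal

/-- The lower bidiagonal matrix with `1` on the diagonal and `-1` below it. -/
noncomputable def backwardDifference (n : ℕ) :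
    EuclideanSpace ℝ (Fin (n + 1)) →L[ℝ] EuclideanSpace ℝ (Fin (n + 1)) :=
  LinearMap.toContinuousLinearMap
    { toFun := fun x => WithLp.toLp 2 fun i => x i - Fin.cases 0 (fun j => x j.castSucc) i
      map_add' := fun x y => by
        ext i
        refine Fin.cases ?_ (fun j => ?_) i <;> simp
        ring
      map_smul' := fun c x => by
        ext i
        refine Fin.cases ?_ (fun j => ?_) i <;> simp
        ring }

variable {n : ℕ}

@[simp]
theorem backwardDifference_zero (x : EuclideanSpace ℝ (Fin (n + 1))) :
    backwardDifference n x 0 = x 0 := by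
  simp [backwardDifference]

@[simp]
theorem backwardDifference_succ (x : EuclideanSpace ℝ (Fin (n + 1))) (j : Fin n) :
    backwardDifference n x j.succ = x j.succ - x j.castSucc := by
  simp [backwardDifference]

/-- By `(a - b)² ≤ 2a² + 2b²`, with each coordinate occurring in at most two entries. -/
theorem norm_backwardDifference_le : ‖backwardDifference n‖ ≤ 2 := by
  refine ContinuousLinearMap.opNorm_le_bound _ zero_le_two fun x => ?_
  refine le_of_pow_le_pow_left₀ two_ne_zero (by positivity) ?_
  rw [mul_pow, EuclideanSpace.real_norm_sq_eq, EuclideanSpace.real_norm_sq_eq, Fin.sum_univ_succ]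
  simp only [backwardDifference_zero, backwardDifference_succ]
  have h1 : ∑ j : Fin n, (x j.succ - x j.castSucc) ^ 2 ≤
      ∑ j : Fin n, (2 * x j.succ ^ 2 + 2 * x j.castSucc ^ 2) :=
    Finset.sum_le_sum fun j _ => by nlinarith [sq_nonneg (x j.succ + x j.castSucc)]
  rw [Finset.sum_add_distrib, ← Finset.mul_sum, ← Finset.mul_sum] at h1
  have h2 := Fin.sum_univ_succ fun i => x i ^ 2
  have h3 := Fin.sum_univ_castSucc fun i => x i ^ 2
  nlinarith [sq_nonneg (x 0), sq_nonneg (x (Fin.last n))]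

/-- The entries of `backwardDifference n x` sum up to the last entry of `x`. -/
theorem sum_backwardDifference (x : EuclideanSpace ℝ (Fin (n + 1))) :
    ∑ i, backwardDifference n x i = x (Fin.last n) := by
  rw [Fin.sum_univ_succ]
  simp only [backwardDifference_zero, backwardDifference_succ, Finset.sum_sub_distrib]
  have h2 := Fin.sum_univ_succ fun i => x i
  have h3 := Fin.sum_univ_castSucc fun i => x i
  linarith

theorem backwardDifference_const (t : ℝ) :
    backwardDifference n (WithLp.toLp 2 fun _ => t) = EuclideanSpace.single 0 t := by
  ext i
  refine Fin.cases ?_ (fun j => ?_) i <;> simp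

/-- The ramp is the test vector for the gradient bound: pairing it with `Zᵀ u` gives the sum of the
entries of `u`. -/
theorem backwardDifference_ramp :
    backwardDifference n (WithLp.toLp 2 fun i => (i : ℝ) + 1) = WithLp.toLp 2 fun _ => 1 := by
  ext i
  refine Fin.cases ?_ (fun j => ?_) i <;> simp

/-! ### Supports of the iterates and size of the hypergradient -/

/-- The vectors whose entries from the `k`-th on vanish. -/
def initialSubspace (n k : ℕ) : Submodule ℝ (EuclideanSpace ℝ (Fin (n + 1))) where
  carrier := {x | ∀ i, k ≤ i.val → x i = 0}
  zero_mem' := fun _ _ => rfl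
  add_mem' := fun hx hy i hi => by simp [hx i hi, hy i hi]
  smul_mem' := fun c x hx i hi => by simp [hx i hi]

theorem initialSubspace_mono : Monotone (initialSubspace n) :=
  fun _ _ hkl _ hx i hi => hx i (hkl.trans hi)

theorem single_zero_mem (t : ℝ) {k : ℕ} (hk : 1 ≤ k) :
    EuclideanSpace.single 0 t ∈ initialSubspace n k := by
  intro i hi
  have : i ≠ 0 := by
    rintro rfl
    simp at hi
    omega
  simp [this]

theorem backwardDifference_mem {k : ℕ} {x : EuclideanSpace ℝ (Fin (n + 1))}
    (hx : x ∈ initialSubspace n k) : backwardDifference n x ∈ initialSubspace n (k + 1) := by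
  intro i
  refine Fin.cases (fun hi => ?_) (fun j hj => ?_) i
  · simp at hi
  · simp only [Fin.val_succ] at hj
    rw [backwardDifference_succ, hx j.succ (by simp only [Fin.val_succ]; omega),
      hx j.castSucc (by simp only [Fin.val_castSucc]; omega), sub_zero]

/-- The transpose is upper bidiagonal, so it moves support only towards lower indices. -/
theorem adjoint_backwardDifference_mem {k : ℕ} {y : EuclideanSpace ℝ (Fin (n + 1))}
    (hy : y ∈ initialSubspace n k) :
    ContinuousLinearMap.adjoint (backwardDifference n) y ∈ initialSubspace n k := by
  intro i hi
  have h := EuclideanSpace.inner_single_left (𝕜 := ℝ) i 1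
    (ContinuousLinearMap.adjoint (backwardDifference n) y)
  rw [map_one, one_mul, ContinuousLinearMap.adjoint_inner_right, PiLp.inner_apply] at h
  rw [← h]
  refine Finset.sum_eq_zero fun j _ => ?_
  rcases le_or_gt k j.val with hkj | hjk
  · simp [hy j hkj]
  -- Entry `(j, i)` of the matrix lies strictly above the diagonal.
  · have hji : j.val < i.val := hjk.trans_le hi
    suffices backwardDifference n (EuclideanSpace.single i 1) j = 0 by simp [this]
    clear hjk
    revert hji
    refine Fin.cases (fun hj => ?_) (fun m hm => ?_) j
    · rw [backwardDifference_zero]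
      exact PiLp.single_eq_of_ne 2 (Fin.ne_of_val_ne hj.ne) _
    · rw [backwardDifference_succ]
      have h1 : m.succ ≠ i := Fin.ne_of_val_ne hm.ne
      have h2 : m.castSucc ≠ i := by
        refine Fin.ne_of_val_ne ?_
        simp only [Fin.val_succ] at hm
        simp only [Fin.val_castSucc]
        omega
      simp [h1, h2]

/-- The gradient of the least-squares function `‖Z x - t e₀‖² / 2` is large as long as the last
entry of `x` vanishes. -/
theorem le_norm_adjoint_backwardDifference {x : EuclideanSpace ℝ (Fin (n + 1))} {t : ℝ}
    (ht : 0 ≤ t) (hx : x (Fin.last n) = 0) :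
    t ^ 2 ≤ (n + 1 : ℝ) ^ 3 * ‖ContinuousLinearMap.adjoint (backwardDifference n)
      (backwardDifference n x - EuclideanSpace.single 0 t)‖ ^ 2 := by
  set g := ContinuousLinearMap.adjoint (backwardDifference n)
    (backwardDifference n x - EuclideanSpace.single 0 t) with hg
  set v : EuclideanSpace ℝ (Fin (n + 1)) := WithLp.toLp 2 fun i => (i : ℝ) + 1 with hv
  -- The pairing is the sum of the entries of the residual, which telescopes to the last entry of
  -- `x` minus `t`. Cauchy–Schwarz then bounds `‖g‖` from below.
  have hgv : ⟪g, v⟫_ℝ = -t := by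
    rw [hg, ContinuousLinearMap.adjoint_inner_left, backwardDifference_ramp, inner_sub_left,
      EuclideanSpace.inner_single_left]
    have : ⟪backwardDifference n x, WithLp.toLp 2 fun _ => (1 : ℝ)⟫_ℝ = 0 := by
      rw [← hx, ← sum_backwardDifference x, PiLp.inner_apply]
      simp
    rw [this]
    simp
  have hv2 : ‖v‖ ^ 2 ≤ (n + 1 : ℝ) ^ 3 := by
    rw [EuclideanSpace.real_norm_sq_eq]
    calc ∑ i, v i ^ 2 ≤ ∑ _i : Fin (n + 1), ((n : ℝ) + 1) ^ 2 := by
          refine Finset.sum_le_sum fun i _ => ?_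
          have : (i : ℝ) ≤ n := by exact_mod_cast Nat.lt_succ_iff.1 i.2
          simp only [hv]
          gcongr
      _ = ((n : ℝ) + 1) ^ 3 := by
          simp
          ring
  have h := abs_real_inner_le_norm g v
  rw [hgv, abs_neg, abs_of_nonneg ht] at h
  calc t ^ 2 ≤ (‖g‖ * ‖v‖) ^ 2 := by gcongr
    _ = ‖v‖ ^ 2 * ‖g‖ ^ 2 := by ring
    _ ≤ _ := by gcongr

/-- With inner Hessian `μ • 1` every factor of the product is a scalar. -/
theorem one_sub_smul_one_pow_apply_mem {E : Type*} [NormedAddCommGroup E] [NormedSpace ℝ E]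
    (Y : Submodule ℝ E) (α μ : ℝ) (m : ℕ) {v : E} (hv : v ∈ Y) :
    ((1 - α • μ • (1 : E →L[ℝ] E)) ^ m) v ∈ Y := by
  induction m with
  | zero => simpa using hv
  | succ m ih =>
    rw [pow_succ']
    exact sub_mem ih (Y.smul_mem _ (Y.smul_mem _ ih))

open leastSquaresBilevel in
/-- Each iteration uncovers at most one more coordinate. -/
theorem searchSpaces_le (t Lx Ly L μ : ℝ) (S : UpdateSchedule) (k : ℕ) :
    ((leastSquaresBilevel (backwardDifference n) (EuclideanSpace.single 0 t)
        Lx Ly L μ).searchSpaces S k).1 ≤ initialSubspace n k ∧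
      ((leastSquaresBilevel (backwardDifference n) (EuclideanSpace.single 0 t)
        Lx Ly L μ).searchSpaces S k).2 ≤ initialSubspace n k := by
  -- New coordinates enter only through the residual; the summand `t e₀` starts the chain at `i =
  -- 0`.
  have hres : ∀ {i : ℕ} {x : EuclideanSpace ℝ (Fin (n + 1))}, x ∈ initialSubspace n i →
      backwardDifference n x - EuclideanSpace.single 0 t ∈ initialSubspace n (i + 1) :=
    fun hx => sub_mem (backwardDifference_mem hx) (single_zero_mem t (by omega))
  induction k using Nat.strong_induction_on with
  | _ k ih =>
    cases k with
    | zero => simp [BilevelProblem.searchSpaces]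
    | succ k =>
      have hmono : ∀ i : Fin (k + 1), initialSubspace n (i + 1) ≤ initialSubspace n (k + 1) :=
        fun i => initialSubspace_mono i.2
      rw [BilevelProblem.searchSpaces]
      refine ⟨?_, ?_⟩
      · split_ifs
        · refine Submodule.span_le.2 (Set.iUnion_subset fun i => ?_)
          obtain ⟨hX, hY⟩ := ih i i.2
          have hup := initialSubspace_mono (n := n) (Nat.le_succ i.1)
          rintro v (hv | ⟨x, hx, y, -, rfl⟩ |
            ⟨m, -, α, x₀, -, y₀, -, xh, -, yh, hyh, xs, ys, -, -, rfl⟩)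
          · exact hmono i (hup (hX hv))
          · rw [gradXf_eq]
            exact hmono i (Submodule.smul_mem _ _ (adjoint_backwardDifference_mem (hres (hX hx))))
          -- A Jacobian product starts from a multiple of `yh` and applies scalars and `Zᵀ`, so it
          -- uncovers nothing.
          · simp only [hessYg_eq, gradYf_eq, jacXYg_eq, List.ofFn_const, List.prod_replicate]
            exact hmono i (hup (Submodule.smul_mem _ _ (adjoint_backwardDifference_mem
              (one_sub_smul_one_pow_apply_mem _ _ _ _ (Submodule.smul_mem _ _ (hY hyh))))))
        · exact (ih k (by omega)).1.trans (initialSubspace_mono (Nat.le_succ k))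
      · refine Submodule.span_le.2 (Set.iUnion_subset fun i => ?_)
        obtain ⟨hX, hY⟩ := ih i i.2
        have hup := initialSubspace_mono (n := n) (Nat.le_succ i.1)
        rintro v (hv | ⟨x, hx, y, hy, rfl⟩)
        · exact hmono i (hup (hY hv))
        · rw [gradYg_eq]
          exact hmono i (sub_mem (Submodule.smul_mem _ _ (hup (hY hy)))
            (Submodule.smul_mem _ _ (hres (hX hx))))

/-- An output of fewer than `n + 1` iterations has a large hypergradient. -/
theorem le_norm_gradient_Phi_output {t Lx Ly L μ : ℝ} (ht : 0 ≤ t) (hμ : 0 < μ)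
    (R : HypergradientRun (leastSquaresBilevel (backwardDifference n) (EuclideanSpace.single 0 t)
      Lx Ly L μ)) (hK : R.schedule.K ≤ n) :
    (Lx + L ^ 2 * Ly / μ ^ 2) ^ 2 * t ^ 2 ≤
      16 * (n + 1 : ℝ) ^ 3 * ‖gradient (leastSquaresBilevel (backwardDifference n)
        (EuclideanSpace.single 0 t) Lx Ly L μ).Phi R.output‖ ^ 2 := by
  -- The last index is `n`, so `K ≤ n` suffices.
  have hx : R.output (Fin.last n) = 0 :=
    (searchSpaces_le t Lx Ly L μ R.schedule R.schedule.K).1 (R.x_mem _ le_rfl) _ hK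
  have h := le_norm_adjoint_backwardDifference ht hx
  rw [leastSquaresBilevel.gradient_Phi_eq _ _ _ _ _ _ hμ, norm_smul, mul_pow, Real.norm_eq_abs,
    sq_abs]
  have h2 := mul_le_mul_of_nonneg_left h (sq_nonneg (Lx + L ^ 2 * Ly / μ ^ 2))
  refine h2.trans_eq ?_
  ring

end LowerBidiagonal

/-! ### The equation for `r*` and its consequences -/

section Scalar

/-- The left side is strictly increasing on `[0, ∞)`, vanishes at `0`, and at `1 + A` exceeds the
right side `A`. -/
theorem existsUnique_isRStar {Lx Ly Ltxy μy β B ε : ℝ} (hμ : 0 < μy) (hβ : 0 ≤ β) :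
    ∃! r : ℝ, IsRStar Lx Ly Ltxy μy β B ε r := by
  unfold IsRStar
  set C := 2 * β ^ 4 / μy ^ 4 + 4 * β ^ 3 / μy ^ 3 + 4 * β ^ 2 / μy ^ 2 with hC
  set A := B ^ 2 * (Ltxy ^ 2 * Ly + Lx * μy ^ 2) ^ 2 / (128 * μy ^ 4 * ε ^ 2) with hA
  have hC0 : 0 ≤ C := by positivity
  have hA0 : 0 ≤ A := by positivity
  have hmono : StrictMonoOn (fun r : ℝ => r ^ 4 + r * C) (Set.Ici 0) := by
    intro r hr s _ hrs
    have h1 : r ^ 4 < s ^ 4 := pow_lt_pow_left₀ hrs hr (by norm_num)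
    have h2 : r * C ≤ s * C := by gcongr
    simp only
    linarith
  have hcont : Continuous (fun r : ℝ => r ^ 4 + r * C) := by fun_prop
  obtain ⟨r, hr, hrA⟩ := intermediate_value_Icc (show (0 : ℝ) ≤ 1 + A by linarith)
    hcont.continuousOn (show A ∈ Set.Icc _ _ from ⟨by simpa using hA0, by
      have h1 : 1 + A ≤ (1 + A) ^ 4 := le_self_pow₀ (by linarith) (by norm_num)
      have h2 : 0 ≤ (1 + A) * C := by positivity
      linarith⟩)
  exact ⟨r, ⟨hr.1, hrA⟩, fun s hs => hmono.injOn hs.1 hr.1 (hs.2.trans hrA.symm)⟩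

/-- Drop the nonnegative `β` terms; this is all that the hard instance needs. -/
theorem IsRStar.pow_four_mul_le {Lx Ly Ltxy μy β B ε r : ℝ}
    (h : IsRStar Lx Ly Ltxy μy β B ε r) (hμ : 0 < μy) (hβ : 0 ≤ β) (hε : 0 < ε) :
    128 * ε ^ 2 * r ^ 4 ≤ B ^ 2 * (Lx + Ltxy ^ 2 * Ly / μy ^ 2) ^ 2 := by
  have h0 := h.1
  have h1 : 0 ≤ r * (2 * β ^ 4 / μy ^ 4 + 4 * β ^ 3 / μy ^ 3 + 4 * β ^ 2 / μy ^ 2) := by positivity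
  calc 128 * ε ^ 2 * r ^ 4
      ≤ 128 * ε ^ 2 * (B ^ 2 * (Ltxy ^ 2 * Ly + Lx * μy ^ 2) ^ 2 / (128 * μy ^ 4 * ε ^ 2)) := by
        gcongr
        linarith [h.2]
    _ = _ := by
        field_simp
        ring

/-- The fourth power of the rate is `128` times the right side of the equation. The linear term may
dominate for small `r`, but with `max 1 r` in place of `r` the quartic one controls it. -/
theorem IsRStar.le_const_mul_max_of_le_mul {Lx Ly Ltxy μy β B ε r κ : ℝ}
    (h : IsRStar Lx Ly Ltxy μy β B ε r) (hLx : 0 ≤ Lx) (hLy : 0 ≤ Ly) (hμ : 0 < μy) (hβ : 0 ≤ β)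
    (hB : 0 ≤ B) (hε : 0 < ε) (hκ : 0 < κ) (hβκ : β ≤ κ * μy) :
    √B * √(Ltxy ^ 2 * Ly + Lx * μy ^ 2) / (μy * √ε) ≤
      128 * (1 + (2 * κ ^ 4 + 4 * κ ^ 3 + 4 * κ ^ 2)) * max 1 r := by
  set D := Ltxy ^ 2 * Ly + Lx * μy ^ 2 with hD
  set C := 2 * κ ^ 4 + 4 * κ ^ 3 + 4 * κ ^ 2 with hC
  have hD0 : 0 ≤ D := by positivity
  have hC0 : 0 ≤ C := by positivity
  have hr0 := h.1
  have hm : 1 ≤ max 1 r := le_max_left _ _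
  have hmr : r ≤ max 1 r := le_max_right _ _
  set ρ := max 1 r
  have hpow : (√B * √D / (μy * √ε)) ^ 4 = 128 * (B ^ 2 * D ^ 2 / (128 * μy ^ 4 * ε ^ 2)) := by
    have e : ∀ a : ℝ, 0 ≤ a → √a ^ 4 = a ^ 2 := fun a ha => by
      rw [show (4 : ℕ) = 2 * 2 from rfl, pow_mul, Real.sq_sqrt ha]
    rw [div_pow, mul_pow, mul_pow, e B hB, e D hD0, e ε hε.le]
    field_simp
  have hcoef : 2 * β ^ 4 / μy ^ 4 + 4 * β ^ 3 / μy ^ 3 + 4 * β ^ 2 / μy ^ 2 ≤ C := by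
    have hb : β / μy ≤ κ := (div_le_iff₀ hμ).2 hβκ
    have hb0 : 0 ≤ β / μy := by positivity
    calc 2 * β ^ 4 / μy ^ 4 + 4 * β ^ 3 / μy ^ 3 + 4 * β ^ 2 / μy ^ 2
        = 2 * (β / μy) ^ 4 + 4 * (β / μy) ^ 3 + 4 * (β / μy) ^ 2 := by
          simp only [div_pow]
          ring
      _ ≤ C := by
          rw [hC]
          gcongr
  refine le_of_pow_le_pow_left₀ (show (4 : ℕ) ≠ 0 by norm_num) (by positivity) ?_
  rw [hpow, ← h.2, mul_pow]
  have h1 : r ^ 4 ≤ ρ ^ 4 := by gcongr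
  have h2 : r * (2 * β ^ 4 / μy ^ 4 + 4 * β ^ 3 / μy ^ 3 + 4 * β ^ 2 / μy ^ 2) ≤ ρ ^ 4 * C :=
    mul_le_mul (hmr.trans (le_self_pow₀ hm (by norm_num))) hcoef (by positivity) (by positivity)
  have h3 : 128 * (1 + C) ≤ (128 * (1 + C)) ^ 4 := le_self_pow₀ (by linarith) (by norm_num)
  calc 128 * (r ^ 4 + r * (2 * β ^ 4 / μy ^ 4 + 4 * β ^ 3 / μy ^ 3 + 4 * β ^ 2 / μy ^ 2))
      ≤ (128 * (1 + C)) * ρ ^ 4 := by linarith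
    _ ≤ (128 * (1 + C)) ^ 4 * ρ ^ 4 := by gcongr

/-- Write `t` for the rate; then `t μ √ε ≤ 1` and `t ε² ≤ 1`. If `t` exceeds `ρ = max 1 r`,
multiplying the equation by `t ^ 4` turns it into `A t⁴ ≤ const · ρ t³`. -/
theorem IsRStar.le_const_mul_max_of_le {Lx Ly Ltxy μy β B ε r β₀ : ℝ}
    (h : IsRStar Lx Ly Ltxy μy β B ε r) (hLx : 0 ≤ Lx) (hLy : 0 < Ly) (hL : 0 < Ltxy)
    (hμ : 0 < μy) (hβ : 0 ≤ β) (hB : 0 < B) (hε : 0 < ε) (hβ₀ : β ≤ β₀) :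
    1 / √ε * min (1 / μy) (1 / √(ε ^ 3)) ≤
      (1 + (128 + 512 * (2 * β₀ ^ 4 + 4 * β₀ ^ 3 + 4 * β₀ ^ 2)) / (B ^ 2 * (Ltxy ^ 2 * Ly) ^ 2)) *
        max 1 r := by
  have hβ₀' : 0 ≤ β₀ := hβ.trans hβ₀
  set A := B ^ 2 * (Ltxy ^ 2 * Ly) ^ 2 with hA
  set C := 2 * β₀ ^ 4 + 4 * β₀ ^ 3 + 4 * β₀ ^ 2 with hC
  have hA0 : 0 < A := by positivity
  have hC0 : 0 ≤ C := by positivity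
  have hr0 := h.1
  have hm : 1 ≤ max 1 r := le_max_left _ _
  have hmr : r ≤ max 1 r := le_max_right _ _
  set ρ := max 1 r
  set t := 1 / √ε * min (1 / μy) (1 / √(ε ^ 3)) with ht
  have hs : 0 < √ε := Real.sqrt_pos.2 hε
  have hs2 : √ε ^ 2 = ε := Real.sq_sqrt hε.le
  have ht0 : 0 < t := by positivity
  have ht1 : t * (μy * √ε) ≤ 1 := by
    calc t * (μy * √ε) ≤ 1 / √ε * (1 / μy) * (μy * √ε) := by
          rw [ht]; gcongr; exact min_le_left _ _
      _ = 1 := by field_simp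
  have ht2 : t * ε ^ 2 ≤ 1 := by
    have e : √(ε ^ 3) = √ε ^ 3 := by
      rw [show ε ^ 3 = (√ε ^ 3) ^ 2 by rw [← pow_mul, mul_comm, pow_mul, hs2]]
      exact Real.sqrt_sq (by positivity)
    calc t * ε ^ 2 ≤ 1 / √ε * (1 / √(ε ^ 3)) * ε ^ 2 := by
          rw [ht]; gcongr; exact min_le_right _ _
      _ = 1 := by
          rw [e, show ε ^ 2 = √ε ^ 4 by rw [← hs2, Real.sqrt_sq hs.le]; ring]
          field_simp
  have ht3 : t ^ 2 * (μy ^ 2 * ε) ≤ 1 := by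
    calc t ^ 2 * (μy ^ 2 * ε) = t ^ 2 * (μy ^ 2 * √ε ^ 2) := by rw [hs2]
      _ = (t * (μy * √ε)) ^ 2 := by ring
      _ ≤ 1 := pow_le_one₀ (by positivity) ht1
  have hq : 0 ≤ (128 + 512 * C) / A := by positivity
  rcases le_total t ρ with htρ | hρt
  · nlinarith [mul_nonneg hq (zero_le_one.trans hm)]
  have ht1' : 1 ≤ t := hm.trans hρt
  -- From `t ε² ≤ 1` and `t ≥ 1`.
  have hε1 : ε ≤ 1 := by
    refine le_of_pow_le_pow_left₀ two_ne_zero zero_le_one ?_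
    nlinarith [sq_nonneg ε]
  -- The equation cleared of `μ⁴`, without the `Lx` term on the side bounded below; `2 + 2 μ²`
  -- dominates `1`, `μ` and `μ²` alike.
  have hA1 : A ≤ 128 * ε ^ 2 * (μy ^ 4 * ρ ^ 4 + ρ * (C * (2 + 2 * μy ^ 2))) := by
    have e1 : 128 * ε ^ 2 * (μy ^ 4 * r ^ 4 +
        r * (2 * β ^ 4 + 4 * β ^ 3 * μy + 4 * β ^ 2 * μy ^ 2)) =
        B ^ 2 * (Ltxy ^ 2 * Ly + Lx * μy ^ 2) ^ 2 := by
      have h2 := h.2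
      field_simp at h2
      linarith
    have e2 : A ≤ B ^ 2 * (Ltxy ^ 2 * Ly + Lx * μy ^ 2) ^ 2 := by
      rw [hA]
      gcongr
      have : 0 ≤ Lx * μy ^ 2 := by positivity
      linarith
    have e3 : 2 * β ^ 4 + 4 * β ^ 3 * μy + 4 * β ^ 2 * μy ^ 2 ≤ C * (2 + 2 * μy ^ 2) := by
      have a1 : μy ≤ 2 + 2 * μy ^ 2 := by nlinarith [sq_nonneg (μy - 1)]
      have a2 : μy ^ 2 ≤ 2 + 2 * μy ^ 2 := by nlinarith
      have a3 : 1 ≤ 2 + 2 * μy ^ 2 := by nlinarith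
      calc 2 * β ^ 4 + 4 * β ^ 3 * μy + 4 * β ^ 2 * μy ^ 2
          = 2 * β ^ 4 * 1 + 4 * β ^ 3 * μy + 4 * β ^ 2 * μy ^ 2 := by ring
        _ ≤ 2 * β₀ ^ 4 * (2 + 2 * μy ^ 2) + 4 * β₀ ^ 3 * (2 + 2 * μy ^ 2) +
            4 * β₀ ^ 2 * (2 + 2 * μy ^ 2) := by gcongr
        _ = C * (2 + 2 * μy ^ 2) := by rw [hC]; ring
    rw [← e1] at e2
    refine e2.trans ?_
    gcongr
  have k1 : ε ^ 2 * μy ^ 4 * t ^ 4 ≤ 1 := by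
    calc ε ^ 2 * μy ^ 4 * t ^ 4 = (t ^ 2 * (μy ^ 2 * ε)) ^ 2 := by ring
      _ ≤ 1 := pow_le_one₀ (by positivity) ht3
  have k2 : ε ^ 2 * t ^ 4 ≤ t ^ 3 := by
    calc ε ^ 2 * t ^ 4 = t * ε ^ 2 * t ^ 3 := by ring
      _ ≤ 1 * t ^ 3 := by gcongr
      _ = t ^ 3 := one_mul _
  have k3 : ε ^ 2 * μy ^ 2 * t ^ 4 ≤ t ^ 3 := by
    calc ε ^ 2 * μy ^ 2 * t ^ 4 = t ^ 2 * (μy ^ 2 * ε) * (ε * t ^ 2) := by ring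
      _ ≤ 1 * (1 * t ^ 2) := by gcongr
      _ ≤ t ^ 3 := by
          rw [one_mul, one_mul]
          exact pow_le_pow_right₀ ht1' (by norm_num)
  have k4 : A * t ^ 4 ≤ (128 + 512 * C) * ρ * t ^ 3 := by
    calc A * t ^ 4
        ≤ 128 * ε ^ 2 * (μy ^ 4 * ρ ^ 4 + ρ * (C * (2 + 2 * μy ^ 2))) * t ^ 4 := by gcongr
      _ = 128 * ρ * ρ ^ 3 * (ε ^ 2 * μy ^ 4 * t ^ 4) +
          256 * (C * ρ) * (ε ^ 2 * t ^ 4 + ε ^ 2 * μy ^ 2 * t ^ 4) := by ring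
      _ ≤ 128 * ρ * t ^ 3 * 1 + 256 * (C * ρ) * (t ^ 3 + t ^ 3) := by gcongr
      _ = _ := by ring
  have k5 : A * t ≤ (128 + 512 * C) * ρ := by
    refine le_of_mul_le_mul_right ?_ (show 0 < t ^ 3 by positivity)
    calc A * t * t ^ 3 = A * t ^ 4 := by ring
      _ ≤ _ := k4
  calc t ≤ (128 + 512 * C) * ρ / A := by rw [le_div_iff₀ hA0]; linarith
    _ = (128 + 512 * C) / A * ρ := mul_div_right_comm _ _ _
    _ ≤ (1 + (128 + 512 * C) / A) * ρ := by
        gcongr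
        linarith

end Scalar

/-! ### The hard instance and the complexity bounds -/

/-- An instance on which no run reaches accuracy `ε` in fewer than `⌊r⌋` iterations. -/
theorem exists_hard_instance {Lx Lxy Ly Ltxy Lty ρxy ρyy μy B ε β r : ℝ}
    (hLx : 0 ≤ Lx) (hLxy : 0 ≤ Lxy) (hLy : 0 ≤ Ly) (hL : 0 ≤ Ltxy) (hρxy : 0 ≤ ρxy)
    (hρyy : 0 ≤ ρyy) (hμ : 0 < μy) (hμL : μy ≤ Lty) (hB : 0 < B) (hε : 0 < ε) (hβ : 0 ≤ β)
    (hr : IsRStar Lx Ly Ltxy μy β B ε r) :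
    ∃ (d : ℕ) (P : BilevelProblem d d), InCSC Lx Lxy Ly Ltxy Lty ρxy ρyy μy B P ∧
      ∀ R : HypergradientRun P, ‖gradient P.Phi R.output‖ ≤ ε → ⌊r⌋₊ ≤ R.schedule.K := by
  -- If `⌊r⌋₊ = 0` the subtraction truncates, but then the bound on `K` is trivial.
  set n := ⌊r⌋₊ - 1 with hn
  -- This makes the minimiser `t (1, …, 1)` have norm `B`.
  set t := B / √(n + 1 : ℝ) with ht
  have hn0 : (0 : ℝ) < n + 1 := by positivity
  have ht0 : 0 < t := by positivity
  have ht2 : (n + 1 : ℝ) * t ^ 2 = B ^ 2 := by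
    rw [ht, div_pow, Real.sq_sqrt hn0.le]
    field_simp
  refine ⟨n + 1, leastSquaresBilevel (LowerBidiagonal.backwardDifference n)
    (EuclideanSpace.single 0 t) Lx Ly Ltxy μy,
    leastSquaresBilevel.inCSC hLx hLxy hLy hL hρxy hρyy hμ hμL
      LowerBidiagonal.norm_backwardDifference_le (LowerBidiagonal.backwardDifference_const t) ?_,
    fun R hR => ?_⟩
  · rw [EuclideanSpace.norm_eq, ← Real.sqrt_sq hB.le, ← ht2]
    simp
  · by_contra! hK
    have hn1 : n + 1 = ⌊r⌋₊ := by omega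
    have hnr : (n + 1 : ℝ) ≤ r := by
      have := Nat.floor_le hr.1
      rw [← hn1] at this
      exact_mod_cast this
    have h1 := LowerBidiagonal.le_norm_gradient_Phi_output ht0.le hμ R (by omega)
    have h2 := hr.pow_four_mul_le hμ hβ hε
    -- The contradiction comes from `16 < 128`.
    have h3 : B ^ 2 * (Lx + Ltxy ^ 2 * Ly / μy ^ 2) ^ 2 ≤ 16 * ε ^ 2 * r ^ 4 := by
      calc B ^ 2 * (Lx + Ltxy ^ 2 * Ly / μy ^ 2) ^ 2
          = (n + 1 : ℝ) * ((Lx + Ltxy ^ 2 * Ly / μy ^ 2) ^ 2 * t ^ 2) := by rw [← ht2]; ring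
        _ ≤ (n + 1 : ℝ) * (16 * (n + 1 : ℝ) ^ 3 * ε ^ 2) := by
            refine mul_le_mul_of_nonneg_left (h1.trans ?_) hn0.le
            gcongr
        _ = 16 * ε ^ 2 * (n + 1 : ℝ) ^ 4 := by ring
        _ ≤ 16 * ε ^ 2 * r ^ 4 := by gcongr
    have h4 : 0 < ε ^ 2 * r ^ 4 := by
      have : 0 < r := hn0.trans_le hnr
      positivity
    linarith

/-- Since `Q, T ≥ 1`, a run costs at least `2τ + K`. The fixed part `2τ` pays for `r < 1` and for
the fraction lost in `⌊r⌋`. -/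
theorem HypergradientRun.min_mul_max_le_cost {p q : ℕ} {P : BilevelProblem p q}
    (R : HypergradientRun P) {τ r : ℝ} (hτ : 0 < τ) (hr : ⌊r⌋₊ ≤ R.schedule.K) :
    min (2 * τ) 1 * max 1 r ≤ R.cost τ := by
  have hQ : (1 : ℝ) ≤ R.schedule.Q := by exact_mod_cast R.schedule.Q_pos
  have hT : (1 : ℝ) ≤ R.schedule.T := by exact_mod_cast R.schedule.T_pos
  have hQT : (1 : ℝ) ≤ R.schedule.Q * R.schedule.T := by nlinarith
  have hK : max 1 r ≤ 1 + R.schedule.K := by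
    refine max_le (by simp) ((Nat.lt_floor_add_one r).le.trans ?_)
    rw [add_comm]
    gcongr
  have hm : 0 ≤ min (2 * τ) 1 := by positivity
  simp only [HypergradientRun.cost, HypergradientRun.nJ, HypergradientRun.nH, HypergradientRun.nG,
    Nat.cast_mul]
  calc min (2 * τ) 1 * max 1 r ≤ min (2 * τ) 1 * (1 + R.schedule.K) := by gcongr
    _ = min (2 * τ) 1 + min (2 * τ) 1 * R.schedule.K := by ring
    _ ≤ 2 * τ + 1 * R.schedule.K := by
        gcongr
        · exact min_le_left _ _
        · exact min_le_right _ _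
    _ ≤ _ := by nlinarith

theorem le_normComplexity {p q : ℕ} {P : BilevelProblem p q} {τ ε c : ℝ}
    (A : HypergradientAlgorithm)
    (h : ∀ R : HypergradientRun P, ‖gradient P.Phi R.output‖ ≤ ε → c ≤ R.cost τ) :
    ENNReal.ofReal c ≤ normComplexity τ A P ε :=
  le_iInf₂ fun R _ => le_iInf fun hR => ENNReal.ofReal_le_ofReal (h R hR)

theorem mainTheorem7 :
    -- `c₀ τ`, `c₁ τ κ`, `c₂ τ β₀ Lx Ly Ltxy B` are the constants hidden in the three `Ω`'s
    ∃ (c₀ : ℝ → ℝ) (c₁ : ℝ → ℝ → ℝ) (c₂ : ℝ → ℝ → ℝ → ℝ → ℝ → ℝ → ℝ),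
      (∀ τ, 0 < τ → 0 < c₀ τ) ∧
      (∀ τ κ, 0 < τ → 0 < κ → 0 < c₁ τ κ) ∧
      (∀ τ β₀ Lx Ly Ltxy B, 0 < τ → 0 < β₀ → 0 ≤ Lx → 0 < Ly → 0 < Ltxy → 0 < B →
        0 < c₂ τ β₀ Lx Ly Ltxy B) ∧
      ∀ Lx Lxy Ly Ltxy Lty ρxy ρyy μy B ε β : ℝ,
        0 ≤ Lx → 0 ≤ Lxy → 0 ≤ Ly → 0 ≤ Ltxy → 0 ≤ ρxy → 0 ≤ ρyy →
        0 < μy → μy ≤ Lty → 0 < B → 0 < ε → β = (Lty - μy) / 4 →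
        (∃! r : ℝ, IsRStar Lx Ly Ltxy μy β B ε r) ∧
        ∀ r : ℝ, IsRStar Lx Ly Ltxy μy β B ε r →
          ∃ (d : ℕ) (P : BilevelProblem d d),
            InCSC Lx Lxy Ly Ltxy Lty ρxy ρyy μy B P ∧
            (∀ R : HypergradientRun P, ‖gradient P.Phi R.output‖ ≤ ε →
              ⌊r⌋ - 3 ≤ (R.schedule.K : ℤ) + (R.schedule.Q : ℤ) * (R.schedule.T : ℤ)
                - (R.schedule.Q : ℤ) + 3) ∧
            ∀ (τ : ℝ) (A : HypergradientAlgorithm), 0 < τ →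
              ENNReal.ofReal (c₀ τ * r) ≤ normComplexity τ A P ε ∧
              (∀ κ : ℝ, 0 < κ → β ≤ κ * μy →
                ENNReal.ofReal (c₁ τ κ *
                  (Real.sqrt B * Real.sqrt (Ltxy ^ 2 * Ly + Lx * μy ^ 2) /
                    (μy * Real.sqrt ε))) ≤ normComplexity τ A P ε) ∧
              (∀ β₀ : ℝ, 0 < β₀ → β ≤ β₀ → 0 < Ly → 0 < Ltxy →
                ENNReal.ofReal (c₂ τ β₀ Lx Ly Ltxy B *
                  (1 / Real.sqrt ε * min (1 / μy) (1 / Real.sqrt (ε ^ 3))))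
                    ≤ normComplexity τ A P ε) := by
  refine ⟨fun τ => min (2 * τ) 1,
    fun τ κ => min (2 * τ) 1 / (128 * (1 + (2 * κ ^ 4 + 4 * κ ^ 3 + 4 * κ ^ 2))),
    fun τ β₀ _ Ly Ltxy B => min (2 * τ) 1 / (1 + (128 + 512 * (2 * β₀ ^ 4 + 4 * β₀ ^ 3 +
      4 * β₀ ^ 2)) / (B ^ 2 * (Ltxy ^ 2 * Ly) ^ 2)),
    fun τ hτ => by positivity, fun τ κ hτ hκ => by positivity,
    fun τ β₀ Lx Ly Ltxy B hτ hβ₀ _ hLy hL hB => by positivity, ?_⟩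
  intro Lx Lxy Ly Ltxy Lty ρxy ρyy μy B ε β hLx hLxy hLy hL hρxy hρyy hμ hμL hB hε hβ_eq
  have hβ : 0 ≤ β := by linarith
  refine ⟨existsUnique_isRStar hμ hβ, fun r hr => ?_⟩
  obtain ⟨d, P, hP, hK⟩ := exists_hard_instance hLx hLxy hLy hL hρxy hρyy hμ hμL hB hε hβ hr
  refine ⟨d, P, hP, fun R hR => ?_, fun τ A hτ => ?_⟩
  -- Since `Q ≤ Q T`, already `M ≥ K + 3`.
  · have h1 : ⌊r⌋ ≤ (R.schedule.K : ℤ) := by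
      rw [← Int.natCast_floor_eq_floor hr.1]
      exact_mod_cast hK R hR
    have h2 : (R.schedule.Q : ℤ) ≤ R.schedule.Q * R.schedule.T :=
      le_mul_of_one_le_right (by positivity) (by exact_mod_cast R.schedule.T_pos)
    linarith
  · have hm : 0 < min (2 * τ) 1 := by positivity
    -- All three bounds have this shape: a rate at most `c * max 1 r` yields the constant `min (2 *
    -- τ) 1 / c`.
    have hcost : ∀ {c u : ℝ}, 0 < c → u ≤ c * max 1 r →
        ENNReal.ofReal (min (2 * τ) 1 / c * u) ≤ normComplexity τ A P ε := by
      intro c u hc hu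
      refine le_normComplexity A fun R hR => le_trans ?_ (R.min_mul_max_le_cost hτ (hK R hR))
      calc min (2 * τ) 1 / c * u ≤ min (2 * τ) 1 / c * (c * max 1 r) := by gcongr
        _ = min (2 * τ) 1 * max 1 r := by field_simp
    refine ⟨?_, fun κ hκ hβκ => ?_, fun β₀ hβ₀ hββ₀ hLy' hL' => ?_⟩
    · simpa using hcost one_pos (u := r) (by simp)
    · exact hcost (by positivity)
        (hr.le_const_mul_max_of_le_mul hLx hLy hμ hβ hB.le hε hκ hβκ)
    · exact hcost (by positivity)
        (hr.le_const_mul_max_of_le hLx hLy' hL' hμ hβ hB hε hββ₀)
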